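/- Let $R$ be a commutative artinian ring and let $\Lambda$ be an artin $R$-algebra, i.e. an $R$-algebra that is finitely generated as an $R$-module. Let $\mathrm{mod}\,(\Lambda)$ be the category of finitely generated left $\Lambda$-modules. Let $S_1,\dots,S_n$ be a complete list of pairwise non-isomorphic simple $\Lambda$-modules, ordered by $1<2<\dots<n$, and let $P_i$ be a projective cover of $S_i$. For each $i$ let $U_i=\sum_{f:\oplus_{j>i}P_j\to P_i}\mathrm{Im}\,f$ be the trace of $\bigoplus_{j>i}P_j$ in $P_i$, let $\Delta(i)=P_i/U_i$ be the $i$-th standard module, and put $\Delta=\{\Delta(1),\dots,\Delta(n)\}$. Let $\mathfrak{F}(\Delta)$ be the full subcategory of $\mathrm{mod}\,(\Lambda)$ of all modules $M$ having a finite chain of submodules $0=M_0\le M_1\le\dots\le M_t=M$ ($t\ge 0$) such that each $M_k/M_{k-1}$ is isomorphic to a module in $\Delta$. Assume that $\Lambda$ is quasi-hereditary (with respect to this order), i.e. ${}_\Lambda\Lambda\in\mathfrak{F}(\Delta)$ and $\mathrm{End}_\Lambda(\Delta(i))$ is a division ring for every $i$. If $\mathfrak{F}(\Delta)$ is a thick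 subcategory of $\mathrm{mod}\,(\Lambda)$, i.e. it is closed under direct summands and, whenever two of the terms of a short exact sequence $0\to X\to Y\to Z\to 0$ in $\mathrm{mod}\,(\Lambda)$ belong to $\mathfrak{F}(\Delta)$, so does the third, then $\mathfrak{F}(\Delta)=\mathrm{mod}\,(\Lambda)$. -/

import Mathlib

universe u

/-- The ring `E` is a division ring: it is nonzero and every nonzero element is a unit. -/
def IsDivRing (E : Type u) [Ring E] : Prop :=
  Nontrivial E ∧ ∀ x : E, x ≠ 0 → IsUnit x

section

variable {Λ : Type u} [Ring Λ]

/-- `S 0, …, S (n - 1)` is a complete list of pairwise non-isomorphic simple left `Λ`-modules.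
The linear order on the simple modules is the order of the index set `Fin n`. -/
structure IsCompleteListOfSimples {n : ℕ} (S : Fin n → FGModuleCat.{u} Λ) : Prop where
  simple : ∀ i, IsSimpleModule Λ (S i)
  nonIso : ∀ i j, i ≠ j → IsEmpty (S i ≃ₗ[Λ] S j)
  complete : ∀ T : FGModuleCat.{u} Λ, IsSimpleModule Λ T → ∃ i, Nonempty (T ≃ₗ[Λ] S i)

/-- `P` is a projective cover of `M`: `P` is projective and there is an epimorphism `π : P → M`
whose kernel is superfluous. -/
def IsProjectiveCoverOf (P M : FGModuleCat.{u} Λ) : Prop :=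
  Module.Projective Λ P ∧ ∃ π : P →ₗ[Λ] M, Function.Surjective π ∧
    ∀ N : Submodule Λ P, N ⊔ LinearMap.ker π = ⊤ → N = ⊤

/-- The trace of `X` in `M`: the sum of the images of all homomorphisms `X → M`. -/
def moduleTrace (Λ : Type u) [Ring Λ] (X M : Type u) [AddCommGroup X] [Module Λ X]
    [AddCommGroup M] [Module Λ M] : Submodule Λ M :=
  ⨆ f : X →ₗ[Λ] M, LinearMap.range f

/-- The standard module `Δ(i) = P i / U i`, where `U i` is the trace of `⨁_{j > i} P j` in `P i`. -/
noncomputable def standardModule {n : ℕ} (P : Fin n → FGModuleCat.{u} Λ) (i : Fin n) :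
    FGModuleCat.{u} Λ :=
  FGModuleCat.of Λ
    (P i ⧸ moduleTrace Λ (DirectSum {j : Fin n // i < j} (fun j => P j.1)) (P i))

/-- `𝔉(Θ)`: the modules `M` with a finite chain `0 = F 0 ≤ F 1 ≤ ⋯ ≤ F t = M` of submodules such
that every `F (k + 1) / F k` with `k < t` is isomorphic to a module in `Θ`. -/
def filteredModules (Θ : Set (FGModuleCat.{u} Λ)) :
    CategoryTheory.ObjectProperty (FGModuleCat.{u} Λ) :=
  fun M => ∃ (t : ℕ) (F : ℕ → Submodule Λ M), F 0 = ⊥ ∧ F t = ⊤ ∧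
    ∀ k < t, F k ≤ F (k + 1) ∧
      ∃ X ∈ Θ, Nonempty ((F (k + 1) ⧸ (F k).submoduleOf (F (k + 1))) ≃ₗ[Λ] X)

/-- `𝔉(Δ)`, the class of good modules. -/
def goodModules {n : ℕ} (P : Fin n → FGModuleCat.{u} Λ) :
    CategoryTheory.ObjectProperty (FGModuleCat.{u} Λ) :=
  filteredModules (Set.range (standardModule P))

/-- `(Λ, ≤)` is (left) standardly stratified: the left regular module lies in `𝔉(Δ)`. -/
def IsStandardlyStratified {n : ℕ} (P : Fin n → FGModuleCat.{u} Λ) : Prop :=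
  goodModules P (FGModuleCat.of Λ Λ)

/-- `(Λ, ≤)` is quasi-hereditary: it is standardly stratified and the endomorphism ring of each
standard module is a division ring. -/
def IsQuasiHereditary {n : ℕ} (P : Fin n → FGModuleCat.{u} Λ) : Prop :=
  IsStandardlyStratified P ∧ ∀ i, IsDivRing (Module.End Λ (standardModule P i))

/-- A class `C` in `mod Λ` is thick: it is closed under direct summands, and if two of the terms
of an exact sequence `0 → X → Y → Z → 0` in `mod Λ` lie in `C`, then so does the third. -/
structure IsThickSubcategory (C : CategoryTheory.ObjectProperty (FGModuleCat.{u} Λ)) : Prop where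
  summand : ∀ X Y Z : FGModuleCat.{u} Λ, Nonempty (Y ≃ₗ[Λ] X × Z) → C Y → C X
  two_of_three : ∀ (X Y Z : FGModuleCat.{u} Λ) (f : X →ₗ[Λ] Y) (g : Y →ₗ[Λ] Z),
    Function.Injective f → Function.Exact f g → Function.Surjective g →
      (C X → C Z → C Y) ∧ (C X → C Y → C Z) ∧ (C Y → C Z → C X)

end

section

variable {Λ : Type u} [Ring Λ]

/-! By induction on `i`, every simple `S i` is good. Let `K` be the kernel of `Δ(i) → S i`. Maps `P
j → K` vanish for `j > i` because the trace was factored out, and for `j = i` because `End Δ(i)` is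
a division ring. So `K` has only composition factors `S j` with `j < i`, hence is good, and so is `S
i ≅ Δ(i)/K`. Extensions then give all modules. -/

theorem IsThickSubcategory.of_equiv {C : CategoryTheory.ObjectProperty (FGModuleCat.{u} Λ)}
    (hC : IsThickSubcategory C) {X Y : FGModuleCat.{u} Λ} (e : X ≃ₗ[Λ] Y) (hY : C Y) : C X :=
  hC.summand X Y (FGModuleCat.of Λ PUnit.{u + 1})
    ⟨e.symm.trans (LinearEquiv.prodUnique (R := Λ) (M := X) (M₂ := PUnit.{u + 1})).symm⟩ hY

theorem goodModules_standardModule {n : ℕ} (P : Fin n → FGModuleCat.{u} Λ) (i : Fin n) :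
    goodModules P (standardModule P i) := by
  refine ⟨1, fun k => if k = 0 then ⊥ else ⊤, by simp, by simp, ?_⟩
  intro k hk
  obtain rfl : k = 0 := by omega
  refine ⟨by simp, standardModule P i, ⟨i, rfl⟩, ⟨?_⟩⟩
  refine (Submodule.quotEquivOfEqBot _ ?_).trans Submodule.topEquiv
  simp [Submodule.submoduleOf]

theorem goodModules_of_subsingleton {n : ℕ} (P : Fin n → FGModuleCat.{u} Λ)
    (M : FGModuleCat.{u} Λ) [Subsingleton M] : goodModules P M :=
  ⟨0, fun _ => ⊥, rfl, Subsingleton.elim _ _, fun _ hk => absurd hk (Nat.not_lt_zero _)⟩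

/-- A projective cover of a simple module admits no nonzero map to another simple module. -/
theorem IsProjectiveCoverOf.hom_eq_zero {P S T : FGModuleCat.{u} Λ} (hP : IsProjectiveCoverOf P S)
    [IsSimpleModule Λ S] [IsSimpleModule Λ T] (hST : IsEmpty (S ≃ₗ[Λ] T)) (f : P →ₗ[Λ] T) :
    f = 0 := by
  obtain ⟨-, π, hπ, hsup⟩ := hP
  by_contra hf
  have hfs : Function.Surjective f := LinearMap.surjective_of_ne_zero hf
  have cf : IsCoatom (LinearMap.ker f) := LinearMap.isCoatom_ker_of_surjective hfs
  have cπ : IsCoatom (LinearMap.ker π) := LinearMap.isCoatom_ker_of_surjective hπ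
  have h : LinearMap.ker π = LinearMap.ker f := by
    by_contra hne
    -- Distinct maximal submodules span `P`, which a superfluous `ker π` forbids.
    exact cf.1 (hsup _ (cf.sup_eq_top_of_ne cπ (Ne.symm hne)))
  exact hST.false ((LinearMap.quotKerEquivOfSurjective π hπ).symm.trans
    ((Submodule.quotEquivOfEq _ _ h).trans (LinearMap.quotKerEquivOfSurjective f hfs)))

/-- Maps out of a summand of a direct sum have their image in the trace of that sum. -/
theorem range_le_moduleTrace {ι : Type} [DecidableEq ι] {X : ι → Type u}
    [∀ i, AddCommGroup (X i)] [∀ i, Module Λ (X i)] {M : Type u} [AddCommGroup M] [Module Λ M]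
    (i : ι) (f : X i →ₗ[Λ] M) : LinearMap.range f ≤ moduleTrace Λ (DirectSum ι X) M := by
  refine le_trans ?_ (le_iSup _ (f ∘ₗ DirectSum.component Λ ι X i))
  rintro _ ⟨x, rfl⟩
  exact ⟨DirectSum.lof Λ ι X i x, by simp⟩

variable {n : ℕ} {P : Fin n → FGModuleCat.{u} Λ}

theorem moduleTrace_le_ker {i : Fin n} {M : Type u} [AddCommGroup M] [Module Λ M]
    (f : P i →ₗ[Λ] M) (h : ∀ j, i < j → ∀ g : P j →ₗ[Λ] M, g = 0) :
    moduleTrace Λ (DirectSum {j : Fin n // i < j} (fun j => P j.1)) (P i) ≤ LinearMap.ker f := by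
  refine iSup_le fun g => LinearMap.range_le_ker_iff.2 ?_
  refine DirectSum.linearMap_ext Λ fun j => ?_
  rw [h j.1 j.2 ((f ∘ₗ g) ∘ₗ _), LinearMap.zero_comp]

/-- By projectivity `f` lifts to a map `P j → P i`, whose image lies in the trace that `Δ(i)` kills.
-/
theorem hom_standardModule_eq_zero {i j : Fin n} (hij : i < j) [Module.Projective Λ (P j)]
    (f : P j →ₗ[Λ] standardModule P i) : f = 0 := by
  obtain ⟨g, hg⟩ := Module.projective_lifting_property (Submodule.mkQ
    (moduleTrace Λ (DirectSum {j : Fin n // i < j} (fun j => P j.1)) (P i))) f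
    (Submodule.mkQ_surjective _)
  ext x
  rw [← hg]
  refine (Submodule.Quotient.mk_eq_zero _).2 ?_
  exact range_le_moduleTrace (X := fun j : {j : Fin n // i < j} => P j.1) ⟨j, hij⟩ g ⟨x, rfl⟩

/-- If `End Δ(i)` is a division ring, then no map `P j → Δ(i)` with `i ≤ j` lands in a proper
submodule unless it is zero. -/
theorem hom_submodule_standardModule_eq_zero {i j : Fin n} (hij : i ≤ j)
    (hproj : ∀ j, Module.Projective Λ (P j)) (hdiv : IsDivRing (Module.End Λ (standardModule P i)))
    {K : Submodule Λ (standardModule P i)} (hK : K ≠ ⊤) (f : P j →ₗ[Λ] K) : f = 0 := by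
  have key : K.subtype ∘ₗ f = 0 := by
    obtain hlt | rfl := hij.lt_or_eq
    · have := hproj j
      exact hom_standardModule_eq_zero hlt _
    · have hker := moduleTrace_le_ker (K.subtype ∘ₗ f) fun j hj g =>
        have := hproj j
        hom_standardModule_eq_zero hj g
      -- The induced endomorphism has image in `K`; were it nonzero, it would be onto, forcing `K =
      -- ⊤`.
      let φ : Module.End Λ (standardModule P i) := Submodule.liftQ _ (K.subtype ∘ₗ f) hker
      have hφ : φ = 0 := by
        by_contra hne
        have hs := ((Module.End.isUnit_iff φ).1 (hdiv.2 φ hne)).2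
        refine hK (eq_top_iff.2 fun y _ => ?_)
        obtain ⟨x, rfl⟩ := hs y
        obtain ⟨x, rfl⟩ := Submodule.mkQ_surjective _ x
        exact (f x).2
      ext x
      exact LinearMap.congr_fun hφ (Submodule.Quotient.mk x)
  ext x
  exact LinearMap.congr_fun key x

/-- A thick class contains every finitely generated module all of whose composition factors
lie in it. -/
theorem IsThickSubcategory.of_simples [IsArtinianRing Λ]
    {C : CategoryTheory.ObjectProperty (FGModuleCat.{u} Λ)} (hC : IsThickSubcategory C)
    (hzero : ∀ M : FGModuleCat.{u} Λ, Subsingleton M → C M)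
    {S : Fin n → FGModuleCat.{u} Λ} (hS : IsCompleteListOfSimples S)
    (hP : ∀ i, IsProjectiveCoverOf (P i) (S i)) (M : FGModuleCat.{u} Λ)
    (hM : ∀ i, ¬ C (S i) → ∀ f : P i →ₗ[Λ] M, f = 0) : C M := by
  -- `N` is a maximal submodule lying in `C`. If `N ≠ ⊤`, the preimage of a simple `T ≤ M ⧸ N` will
  -- be a larger one.
  obtain ⟨N, hN, hmax⟩ := WellFounded.has_min (wellFounded_gt (α := Submodule Λ M))
    {N | C (FGModuleCat.of Λ N)} ⟨⊥, hzero _ (inferInstanceAs (Subsingleton (⊥ : Submodule Λ M)))⟩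
  by_cases htop : N = ⊤
  · subst htop
    exact hC.of_equiv (Y := FGModuleCat.of Λ (⊤ : Submodule Λ M)) Submodule.topEquiv.symm hN
  exfalso
  have : Nontrivial (M ⧸ N) := Submodule.Quotient.nontrivial_iff.2 htop
  obtain ⟨T, hT⟩ := IsAtomic.exists_atom (Submodule Λ (M ⧸ N))
  have hTs : IsSimpleModule Λ T := isSimpleModule_iff_isAtom.2 hT
  obtain ⟨i, ⟨e⟩⟩ := hS.complete (FGModuleCat.of Λ T) hTs
  have := hS.simple i
  obtain ⟨hproj, π, hπ, -⟩ := hP i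
  have hCS : C (S i) := by
    by_contra hn
    -- The nonzero map `P i → S i ≅ T ≤ M ⧸ N` lifts to `M`, where `hM` makes it zero.
    obtain ⟨g, hg⟩ := Module.projective_lifting_property N.mkQ
      (T.subtype ∘ₗ e.symm.toLinearMap ∘ₗ π) N.mkQ_surjective
    rw [hM i hn g, LinearMap.comp_zero] at hg
    have := IsSimpleModule.nontrivial Λ (S i)
    obtain ⟨y, hy⟩ := exists_ne (0 : S i)
    obtain ⟨x, rfl⟩ := hπ y
    refine hy (e.symm.injective (Subtype.ext ?_))
    rw [map_zero]
    exact (LinearMap.congr_fun hg x).symm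
  have hCT : C (FGModuleCat.of Λ T) := hC.of_equiv e hCS
  let N' : Submodule Λ M := T.comap N.mkQ
  have hNN' : N ≤ N' := N.le_comap_mkQ T
  let g : N' →ₗ[Λ] T := N.mkQ.restrict fun x hx => hx
  have hg : Function.Surjective g := by
    rintro ⟨y, hy⟩
    obtain ⟨x, rfl⟩ := N.mkQ_surjective y
    exact ⟨⟨x, hy⟩, rfl⟩
  have hexact : Function.Exact (Submodule.inclusion hNN') g := by
    intro x
    constructor
    · intro hx
      exact ⟨⟨x, (Submodule.Quotient.mk_eq_zero N).1 (congrArg Subtype.val hx)⟩, rfl⟩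
    · rintro ⟨y, rfl⟩
      exact Subtype.ext ((Submodule.Quotient.mk_eq_zero N).2 y.2)
  refine hmax N' ((hC.two_of_three (FGModuleCat.of Λ N) (FGModuleCat.of Λ N') (FGModuleCat.of Λ T)
    (Submodule.inclusion hNN') g (Submodule.inclusion_injective hNN') hexact hg).1 hN hCT) ?_
  refine lt_of_le_of_ne hNN' fun heq => hT.1 (eq_bot_iff.2 fun y hy => ?_)
  obtain ⟨x, rfl⟩ := N.mkQ_surjective y
  have hx : x ∈ N := heq ▸ (show x ∈ N' from hy)
  exact (Submodule.Quotient.mk_eq_zero N).2 hx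

end

theorem mainTheorem9 {R : Type*} [CommRing R] [IsArtinianRing R]
    {Λ : Type u} [Ring Λ] [Algebra R Λ] [Module.Finite R Λ]
    {n : ℕ} (S P : Fin n → FGModuleCat.{u} Λ)
    (hS : IsCompleteListOfSimples S)
    (hP : ∀ i, IsProjectiveCoverOf (P i) (S i))
    (hqh : IsQuasiHereditary P)
    (hthick : IsThickSubcategory (goodModules P)) :
    goodModules P = ⊤ := by
  have : IsArtinianRing Λ := IsArtinianRing.of_finite R Λ
  have hzero : ∀ M : FGModuleCat.{u} Λ, Subsingleton M → goodModules P M :=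
    fun M _ => goodModules_of_subsingleton P M
  have hproj : ∀ j, Module.Projective Λ (P j) := fun j => (hP j).1
  have hsimple : ∀ i, goodModules P (S i) := by
    intro i
    induction i using WellFoundedLT.induction with
    | ind i ih =>
      have := hS.simple
      obtain ⟨-, π, hπ, -⟩ := hP i
      let p : standardModule P i →ₗ[Λ] S i := Submodule.liftQ _ π
        (moduleTrace_le_ker π fun j hj g => (hP j).hom_eq_zero (hS.nonIso j i hj.ne') g)
      have hp : Function.Surjective p := fun y =>
        (hπ y).elim fun x hx => ⟨Submodule.Quotient.mk x, hx⟩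
      have hK : LinearMap.ker p ≠ ⊤ := (LinearMap.isCoatom_ker_of_surjective hp).1
      have hCK : goodModules P (FGModuleCat.of Λ (LinearMap.ker p)) :=
        hthick.of_simples hzero hS hP _ fun j hj f =>
          -- By induction, a simple `S j` that is not good must have `i ≤ j`.
          hom_submodule_standardModule_eq_zero (not_lt.1 fun hlt => hj (ih j hlt)) hproj
            (hqh.2 i) hK f
      exact (hthick.two_of_three (FGModuleCat.of Λ (LinearMap.ker p)) (standardModule P i) (S i)
        (LinearMap.ker p).subtype p (Submodule.subtype_injective _)
        (LinearMap.exact_subtype_ker_map p) hp).2.1 hCK (goodModules_standardModule P i)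
  exact eq_top_iff.2 fun M _ => hthick.of_simples hzero hS hP M fun i hi => absurd (hsimple i) hi
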